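/- Let $G$ be a countable group acting by isometries on a Gromov hyperbolic metric space $S$ (not necessarily proper), i.e. there is $\delta\ge 0$ such that $(x,z)_t\ge\min\{(x,y)_t,(y,z)_t\}-\delta$ for all $x,y,z,t\in S$, where $(x,y)_t=\frac12(d(x,t)+d(y,t)-d(x,y))$. Let $\partial S$ be the Gromov boundary of $S$ (equivalence classes of sequences converging at infinity), with the induced action of $G$. For a subgroup $H\le G$ let $\Lambda(H)\subseteq\partial S$ be its limit set, i.e. the set of all limits in $\partial S$ of sequences of points of an $H$-orbit in $S$. Assume that the action of $G$ on $S$ is of general type: $\Lambda(G)$ is infinite and $G$ fixes no point of $\partial S$. Let $$E(G)=\{g\in G\mid g\xi=\xi\ \text{ for all }\xi\in\Lambda(G)\}$$ be the elliptic radical of $G$. Then $E(G)$ is the largest normal subgroup of $G$ that is elliptic, i.e. has bounded orbits in $S$. Moreover, let $\mu$ be an ergodic invariant random subgroup of $G$, that is, a Borel probability measure on the space $\mathrm{Sub}(G)$ of subgroups of $G$ (with the topology inherited from $\{0,1\}^G$) which is invariant under conjugation by $G$ and such that every conjugation-invariant Borel set has measure $0$ or $1$. Then at least one of the following holds: 1.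 $\mu$-almost every subgroup $H$ of $G$ is geometrically dense, i.e. $\Lambda(H)=\Lambda(G)$ and $H$ fixes no point of $\partial S$; 2. $\mu$-almost every subgroup $H$ of $G$ is contained in $E(G)$. -/

import Mathlib

open Filter MeasureTheory
open scoped Pointwise

/-! ### Hyperbolic spaces and the Gromov boundary -/

/-- The Gromov product `(x, y)_z`. -/
noncomputable def gromovProduct {S : Type*} [MetricSpace S] (z x y : S) : ℝ :=
  (dist x z + dist y z - dist x y) / 2

/-- Gromov hyperbolicity of an arbitrary (not necessarily geodesic or proper) metric space. -/
class GromovHyperbolic (S : Type*) [MetricSpace S] : Prop where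
  exists_delta : ∃ δ : ℝ, ∀ x y z t : S,
    min (gromovProduct t x y) (gromovProduct t y z) - δ ≤ gromovProduct t x z

/-- `γ`, restricted to `[0, dist x y]`, is a geodesic from `x` to `y`. -/
def IsGeodesicFromTo {S : Type*} [MetricSpace S] (γ : ℝ → S) (x y : S) : Prop :=
  γ 0 = x ∧ γ (dist x y) = y ∧
    ∀ a ∈ Set.Icc 0 (dist x y), ∀ b ∈ Set.Icc 0 (dist x y), dist (γ a) (γ b) = |a - b|

/-- Geodesic triangles are `δ`-slim: each side lies in the `δ`-neighbourhood of the union of the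
other two. -/
def SlimTriangles (S : Type*) [MetricSpace S] (δ : ℝ) : Prop :=
  ∀ (x y z : S) (γ α β : ℝ → S), IsGeodesicFromTo γ x y → IsGeodesicFromTo α x z →
    IsGeodesicFromTo β z y → ∀ a ∈ Set.Icc 0 (dist x y),
      (∃ b ∈ Set.Icc 0 (dist x z), dist (γ a) (α b) ≤ δ) ∨
      (∃ b ∈ Set.Icc 0 (dist z y), dist (γ a) (β b) ≤ δ)

theorem IsGeodesicFromTo.dist_add {S : Type*} [MetricSpace S] {γ : ℝ → S} {x y : S}
    (h : IsGeodesicFromTo γ x y) {a : ℝ} (ha : a ∈ Set.Icc 0 (dist x y)) :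
    dist x (γ a) + dist (γ a) y = dist x y := by
  obtain ⟨h0, h1, h2⟩ := h
  have e1 := h2 0 ⟨le_rfl, dist_nonneg⟩ a ha
  have e2 := h2 a ha (dist x y) ⟨dist_nonneg, le_rfl⟩
  rw [h0, zero_sub, abs_neg, abs_of_nonneg ha.1] at e1
  rw [h1, abs_of_nonpos (by linarith [ha.2])] at e2
  rw [e1, e2]
  ring

/-- Geodesic spaces with slim triangles are hyperbolic in the sense used here. -/
theorem GromovHyperbolic.of_slimTriangles {S : Type*} [MetricSpace S]
    (hgeo : ∀ x y : S, ∃ γ : ℝ → S, IsGeodesicFromTo γ x y) {δ : ℝ} (hδ : SlimTriangles S δ) :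
    GromovHyperbolic S := by
  refine ⟨⟨3 * δ + 2, fun x y z t => ?_⟩⟩
  obtain ⟨γ, hγ⟩ := hgeo x z
  obtain ⟨α, hα⟩ := hgeo x t
  obtain ⟨β, hβ⟩ := hgeo t z
  have key : ∃ p ∈ Set.Icc 0 (dist x z), dist t (γ p) ≤ gromovProduct t x z + 2 * δ + 2 := by
    have hs := hδ x z t γ α β hγ hα hβ
    have near : ∃ a ∈ Set.Icc 0 (dist x z), ∃ b ∈ Set.Icc 0 (dist x z), |a - b| ≤ 1 ∧
        (∃ u ∈ Set.Icc 0 (dist x t), dist (γ a) (α u) ≤ δ) ∧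
        (∃ u ∈ Set.Icc 0 (dist t z), dist (γ b) (β u) ≤ δ) := by
      have hδ0 : 0 ≤ δ := by
        rcases hs 0 ⟨le_rfl, dist_nonneg⟩ with ⟨u, -, hu⟩ | ⟨u, -, hu⟩ <;>
          exact dist_nonneg.trans hu
      set A : Set ℝ := {a | a ∈ Set.Icc 0 (dist x z) ∧
        ∃ u ∈ Set.Icc 0 (dist x t), dist (γ a) (α u) ≤ δ} with hA
      have h0A : (0 : ℝ) ∈ A := ⟨⟨le_rfl, dist_nonneg⟩, 0, ⟨le_rfl, dist_nonneg⟩, by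
        rw [hγ.1, hα.1, dist_self]; exact hδ0⟩
      have hbd : BddAbove A := ⟨dist x z, fun a ha => ha.1.2⟩
      obtain ⟨a, haA, ha⟩ := exists_lt_of_lt_csSup ⟨0, h0A⟩
        (show sSup A - 1 / 2 < sSup A by linarith)
      have hale : a ≤ sSup A := le_csSup hbd haA
      by_cases hL : dist x z ≤ sSup A + 1 / 2
      · refine ⟨a, haA.1, dist x z, ⟨dist_nonneg, le_rfl⟩, ?_, haA.2, dist t z,
          ⟨dist_nonneg, le_rfl⟩, ?_⟩
        · rw [abs_le]; constructor <;> linarith [haA.1.2]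
        · rw [hγ.2.1, hβ.2.1, dist_self]; exact hδ0
      · push Not at hL
        have hb : sSup A + 1 / 2 ∈ Set.Icc 0 (dist x z) := ⟨by linarith [haA.1.1], hL.le⟩
        refine ⟨a, haA.1, _, hb, ?_, haA.2, ?_⟩
        · rw [abs_le]; constructor <;> linarith
        · rcases hs _ hb with h | h
          · have := le_csSup hbd (show sSup A + 1 / 2 ∈ A from ⟨hb, h⟩)
            linarith
          · exact h
    obtain ⟨a, ha, b, hb, hab, ⟨u, hu, hu'⟩, v, hv, hv'⟩ := near
    refine ⟨a, ha, ?_⟩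
    have e1 := hα.dist_add hu
    have e2 := hβ.dist_add hv
    have e4 : dist (γ a) (γ b) ≤ 1 := (hγ.2.2 a ha b hb).trans_le hab
    have t1 := dist_triangle x (α u) (γ a)
    have t2 := dist_triangle (γ a) (α u) t
    have t3 := dist_triangle4 (γ a) (γ b) (β v) z
    have t4 := dist_triangle4 (γ a) (γ b) (β v) t
    have t5 := dist_triangle x (γ a) z
    have s1 := dist_comm (α u) (γ a)
    have s2 := dist_comm (β v) t
    have s3 := dist_comm t (γ a)
    have s4 := dist_comm z t
    unfold gromovProduct
    linarith
  obtain ⟨p, hp, hpt⟩ := key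
  have far : ∀ (x y q : S), dist x q + dist q y = dist x y → gromovProduct t x y ≤ dist t q := by
    intro x y q h
    have t1 := dist_triangle x q t
    have t2 := dist_triangle y q t
    have s1 := dist_comm y q
    have s2 := dist_comm t q
    unfold gromovProduct
    linarith
  obtain ⟨α', hα'⟩ := hgeo x y
  obtain ⟨β', hβ'⟩ := hgeo y z
  rcases hδ x z y γ α' β' hγ hα' hβ' p hp with ⟨u, hu, hu'⟩ | ⟨u, hu, hu'⟩
  · have h1 := far x y _ (hα'.dist_add hu)
    have h2 := dist_triangle t (γ p) (α' u)
    linarith [min_le_left (gromovProduct t x y) (gromovProduct t y z)]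
  · have h1 := far y z _ (hβ'.dist_add hu)
    have h2 := dist_triangle t (γ p) (β' u)
    linarith [min_le_right (gromovProduct t x y) (gromovProduct t y z)]

/-- `(x_i, y_j)_s → ∞` as `i, j → ∞` (for every base point `s`; the choice is immaterial). -/
def AsymptoticSeq {S : Type*} [MetricSpace S] (x y : ℕ → S) : Prop :=
  ∀ s : S, Tendsto (fun p : ℕ × ℕ => gromovProduct s (x p.1) (y p.2)) atTop atTop

/-- The sequence `x` converges at infinity: `(x_i, x_j)_s → ∞` as `i, j → ∞`. -/
def ConvergesAtInfinity {S : Type*} [MetricSpace S] (x : ℕ → S) : Prop :=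
  AsymptoticSeq x x

theorem AsymptoticSeq.symm {S : Type*} [MetricSpace S] {x y : ℕ → S}
    (h : AsymptoticSeq x y) : AsymptoticSeq y x := by
  intro s
  rw [tendsto_atTop_atTop]
  intro M
  obtain ⟨⟨i, j⟩, hij⟩ := tendsto_atTop_atTop.1 (h s) M
  refine ⟨(j, i), fun p hp => ?_⟩
  have := hij (p.2, p.1) ⟨hp.2, hp.1⟩
  have e : gromovProduct s (y p.1) (x p.2) = gromovProduct s (x p.2) (y p.1) := by
    unfold gromovProduct
    rw [dist_comm (y p.1) (x p.2)]
    ring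
  rw [e]
  exact this

theorem AsymptoticSeq.trans {S : Type*} [MetricSpace S] [GromovHyperbolic S] {x y z : ℕ → S}
    (hxy : AsymptoticSeq x y) (hyz : AsymptoticSeq y z) : AsymptoticSeq x z := by
  intro s
  obtain ⟨δ, hδ⟩ := GromovHyperbolic.exists_delta (S := S)
  rw [tendsto_atTop_atTop]
  intro M
  obtain ⟨⟨i, j⟩, hij⟩ := tendsto_atTop_atTop.1 (hxy s) (M + δ)
  obtain ⟨⟨k, l⟩, hkl⟩ := tendsto_atTop_atTop.1 (hyz s) (M + δ)
  refine ⟨(i, l), fun p hp => ?_⟩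
  have h1 := hij (p.1, max j k) ⟨hp.1, le_max_left _ _⟩
  have h2 := hkl (max j k, p.2) ⟨le_max_right _ _, hp.2⟩
  have h3 := hδ (x p.1) (y (max j k)) (z p.2) s
  have h4 := le_min h1 h2
  dsimp only at h4 ⊢
  linarith

/-- Equivalence of sequences converging at infinity. -/
def gromovSetoid (S : Type*) [MetricSpace S] [GromovHyperbolic S] :
    Setoid {x : ℕ → S // ConvergesAtInfinity x} where
  r x y := AsymptoticSeq x.1 y.1
  iseqv := ⟨fun x => x.2, fun h => h.symm, fun h h' => h.trans h'⟩

/-- The Gromov boundary `∂S`. -/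
def GromovBoundary (S : Type*) [MetricSpace S] [GromovHyperbolic S] : Type _ :=
  Quotient (gromovSetoid S)

/-- The sequence `x` of points of `S` converges to the boundary point `ξ`. -/
def ConvergesToBoundary {S : Type*} [MetricSpace S] [GromovHyperbolic S]
    (x : ℕ → S) (ξ : GromovBoundary S) : Prop :=
  ∃ hx : ConvergesAtInfinity x, Quotient.mk (gromovSetoid S) ⟨x, hx⟩ = ξ

/-! ### Isometric group actions -/

theorem AsymptoticSeq.smul {G S : Type*} [Group G] [MetricSpace S] [MulAction G S]
    [IsIsometricSMul G S] (g : G) {x y : ℕ → S} (h : AsymptoticSeq x y) :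
    AsymptoticSeq (fun n => g • x n) (fun n => g • y n) := by
  intro s
  have e : ∀ a : S, dist (g • a) s = dist a (g⁻¹ • s) := fun a => by
    rw [← dist_smul g a (g⁻¹ • s), smul_inv_smul]
  simpa only [gromovProduct, e, dist_smul] using h (g⁻¹ • s)

/-- The action of `G` on `∂S` induced by `g • (x_n) = (g • x_n)`. -/
instance GromovBoundary.instMulAction {G S : Type*} [Group G] [MetricSpace S]
    [GromovHyperbolic S] [MulAction G S] [IsIsometricSMul G S] :
    MulAction G (GromovBoundary S) where
  smul g := Quotient.map (sa := gromovSetoid S) (sb := gromovSetoid S)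
    (fun x => ⟨fun n => g • x.1 n, AsymptoticSeq.smul g x.2⟩)
    (fun _ _ h => AsymptoticSeq.smul g h)
  one_smul ξ := by
    induction ξ using Quotient.inductionOn with
    | _ x =>
      exact congrArg (Quotient.mk (gromovSetoid S))
        (Subtype.ext (funext fun n => one_smul G (x.1 n)))
  mul_smul g h ξ := by
    induction ξ using Quotient.inductionOn with
    | _ x =>
      exact congrArg (Quotient.mk (gromovSetoid S))
        (Subtype.ext (funext fun n => mul_smul g h (x.1 n)))

section Actions

variable {G : Type*} (S : Type*) [Group G] [MetricSpace S] [MulAction G S] [IsIsometricSMul G S]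

/-- The limit set `Λ(H) ⊆ ∂S`: all boundary points to which some sequence of points of an
`H`-orbit in `S` converges. -/
def limitSet [GromovHyperbolic S] (H : Subgroup G) : Set (GromovBoundary S) :=
  {ξ | ∃ (s : S) (h : ℕ → G), (∀ n, h n ∈ H) ∧ ConvergesToBoundary (fun n => h n • s) ξ}

/-- `H` fixes no point of `∂S`. -/
def FixesNoBoundaryPoint [GromovHyperbolic S] (H : Subgroup G) : Prop :=
  ∀ ξ : GromovBoundary S, ∃ h ∈ H, h • ξ ≠ ξ

variable (G) in
/-- The action of `G` on `S` is of general type: the limit set `Λ(G)` is infinite and `G` fixes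
no point of `∂S`. -/
def IsGeneralType [GromovHyperbolic S] : Prop :=
  (limitSet S (⊤ : Subgroup G)).Infinite ∧ FixesNoBoundaryPoint S (⊤ : Subgroup G)

/-- `H` is geometrically dense in `G`. -/
def IsGeometricallyDense [GromovHyperbolic S] (H : Subgroup G) : Prop :=
  limitSet S H = limitSet S (⊤ : Subgroup G) ∧ FixesNoBoundaryPoint S H

/-- `H` is elliptic: its orbits in `S` are bounded. -/
def IsElliptic (H : Subgroup G) : Prop :=
  ∀ s : S, Bornology.IsBounded {p : S | ∃ h ∈ H, p = h • s}

variable (G) in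
/-- The elliptic radical `E(G)`: all `g ∈ G` that fix `Λ(G)` pointwise. -/
def ellipticRadical [GromovHyperbolic S] : Subgroup G :=
  fixingSubgroup G (limitSet S (⊤ : Subgroup G))

end Actions

/-! ### Invariant random subgroups -/

open Classical in
/-- The topology on the space of subgroups of `G` inherited from the product `{0,1}^G`. -/
noncomputable instance Subgroup.instTopologicalSpaceSub {G : Type*} [Group G] :
    TopologicalSpace (Subgroup G) :=
  TopologicalSpace.induced (fun (H : Subgroup G) (g : G) => decide (g ∈ H)) Pi.topologicalSpace

noncomputable instance Subgroup.instMeasurableSpaceSub {G : Type*} [Group G] : MeasurableSpace (Subgroup G) :=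
  borel (Subgroup G)

/-- An invariant random subgroup of `G`: a conjugation-invariant Borel probability measure on the
space of subgroups (`MulAut.conj g • H = g H g⁻¹`). -/
structure IsIRS {G : Type*} [Group G] (μ : Measure (Subgroup G)) : Prop where
  isProbabilityMeasure : IsProbabilityMeasure μ
  invariant : ∀ (g : G) (A : Set (Subgroup G)), MeasurableSet A →
    μ ((fun H => MulAut.conj g • H) ⁻¹' A) = μ A

/-- An ergodic invariant random subgroup: conjugation-invariant Borel sets have measure `0`
or `1`. -/
structure IsErgodicIRS {G : Type*} [Group G] (μ : Measure (Subgroup G)) : Prop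
    extends IsIRS μ where
  ergodic : ∀ A : Set (Subgroup G), MeasurableSet A →
    (∀ g : G, (fun H => MulAut.conj g • H) ⁻¹' A = A) → μ A = 0 ∨ μ A = 1

/-!
Everything rests on Poincaré recurrence: if the conjugates by `g n` of the subgroups in `D` lie in
`A n` for all large `n`, then `D` is not larger than the set of subgroups lying in infinitely many
of the `A n`. Fix `ξ ∈ Λ(G)` and `g n • s → ξ`.

* If `H` is elliptic and `(g n)⁻¹ * k * g n ∈ H` for infinitely many `n`, then `k` fixes `ξ`. So
  almost every elliptic `H` is contained in `E(G)`.
* A given boundary point `η` has an infinite orbit, and a subgroup that fixes three boundary points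
  is elliptic. So almost no non-elliptic `H` fixes `η`.
* If `p ∈ H` moves the points `(g n)⁻¹ • s` to a different direction seen from `s`, then
  `g n * p * (g n)⁻¹ • s` and `g n • s` lie in nearly the same direction. So `ξ ∈ Λ(H)` for almost
  every non-elliptic `H`.
* If `H` fixes `ζ`, then the conjugate of `H` by `g n` fixes `g n • ζ`, which lies deep in the
  shadow of `g n • s`. A subgroup that fixes a point of this shadow for infinitely many `n` fixes
  `ξ`, which the second point rules out. So almost no non-elliptic `H` fixes a boundary point.

As `S` need not be proper, the points `(g n)⁻¹ • s` need not accumulate in `∂S`; but they have a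
subsequence that either converges or has uniformly bounded pairwise Gromov products, and such
sequences serve the last two arguments just as well.
-/
/-! ### The Gromov product -/

section GromovProduct

variable {S : Type*} [MetricSpace S]

theorem gromovProduct_comm (t x y : S) : gromovProduct t x y = gromovProduct t y x := by
  rw [gromovProduct, gromovProduct, dist_comm x y, add_comm (dist x t)]

theorem gromovProduct_self (t x : S) : gromovProduct t x x = dist x t := by
  rw [gromovProduct, dist_self, sub_zero, add_self_div_two]

theorem gromovProduct_le_add_dist_base (t t' x y : S) :
    gromovProduct t x y ≤ gromovProduct t' x y + dist t t' := by
  unfold gromovProduct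
  linarith [dist_triangle x t' t, dist_triangle y t' t, dist_comm t t']

theorem gromovProduct_le_add_dist_right (t x y y' : S) :
    gromovProduct t x y ≤ gromovProduct t x y' + dist y y' := by
  unfold gromovProduct
  linarith [dist_triangle y y' t, dist_triangle x y y']

theorem gromovProduct_add_gromovProduct_swap (t x y : S) :
    gromovProduct t x y + gromovProduct x t y = dist x t := by
  unfold gromovProduct
  linarith [dist_comm t x, dist_comm y t, dist_comm y x]

section Isometry

variable {G : Type*} [Group G] [MulAction G S] [IsIsometricSMul G S]

theorem gromovProduct_smul (g : G) (t x y : S) :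
    gromovProduct (g • t) (g • x) (g • y) = gromovProduct t x y := by
  simp only [gromovProduct, dist_smul]

theorem gromovProduct_smul_base (g : G) (t x y : S) :
    gromovProduct (g • t) x y = gromovProduct t (g⁻¹ • x) (g⁻¹ • y) := by
  rw [← gromovProduct_smul g t, smul_inv_smul, smul_inv_smul]

theorem gromovProduct_smul_right (g : G) (s x : S) :
    gromovProduct s (g • s) (g • x) = dist (g • s) s - gromovProduct s x (g⁻¹ • s) := by
  have h := gromovProduct_add_gromovProduct_swap s (g • s) (g • x)
  rw [gromovProduct_smul_base g s s, inv_smul_smul, gromovProduct_comm s (g⁻¹ • s)] at h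
  exact eq_sub_of_add_eq h

end Isometry

end GromovProduct

/-! ### The four-point inequality -/

section FourPoint

/-- The four-point inequality with constant `δ`; `GromovHyperbolic S` says that it holds for some
`δ`. -/
def IsHyperbolicWith (S : Type*) [MetricSpace S] (δ : ℝ) : Prop :=
  ∀ x y z t : S, min (gromovProduct t x y) (gromovProduct t y z) - δ ≤ gromovProduct t x z

variable {S : Type*} [MetricSpace S] {δ : ℝ}

theorem exists_isHyperbolicWith (S : Type*) [MetricSpace S] [GromovHyperbolic S] :
    ∃ δ : ℝ, IsHyperbolicWith S δ :=
  GromovHyperbolic.exists_delta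

theorem IsHyperbolicWith.nonneg (hδ : IsHyperbolicWith S δ) (s : S) : 0 ≤ δ := by
  have := hδ s s s s
  rw [min_self] at this
  linarith

theorem IsHyperbolicWith.sub_le_gromovProduct (hδ : IsHyperbolicWith S δ) {t x y z : S} {a : ℝ}
    (hxy : a ≤ gromovProduct t x y) (hyz : a ≤ gromovProduct t y z) :
    a - δ ≤ gromovProduct t x z := by
  linarith [hδ x y z t, le_min hxy hyz]

theorem IsHyperbolicWith.gromovProduct_le_or_le (hδ : IsHyperbolicWith S δ) {t x z : S} {a : ℝ}
    (h : gromovProduct t x z ≤ a) (y : S) :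
    gromovProduct t x y ≤ a + δ ∨ gromovProduct t y z ≤ a + δ := by
  rw [← min_le_iff]
  linarith [hδ x y z t]

theorem exists_and_of_pairwise_or {p q : Fin 3 → Prop} (hp : Pairwise fun i j => p i ∨ p j)
    (hq : Pairwise fun i j => q i ∨ q j) : ∃ i, p i ∧ q i := by
  have h01 : (0 : Fin 3) ≠ 1 := by decide
  have h02 : (0 : Fin 3) ≠ 2 := by decide
  have h12 : (1 : Fin 3) ≠ 2 := by decide
  by_contra! h
  grind [hp h01, hp h02, hp h12, hq h01, hq h02, hq h12, h 0, h 1, h 2]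

/- Seen from `s`, at most one of the three points lies in the direction of `t`, and seen from `t`
at most one lies in the direction of `s`. The remaining point is off both directions, which makes
the distance small. -/
theorem IsHyperbolicWith.dist_le_of_pairwise (hδ : IsHyperbolicWith S δ) {s t : S} {a : Fin 3 → S}
    {C : ℝ} (hs : Pairwise fun i j => gromovProduct s (a i) (a j) ≤ C)
    (ht : Pairwise fun i j => gromovProduct t (a i) (a j) ≤ C) : dist s t ≤ 2 * (C + δ) := by
  have off : ∀ {p : S} (q : S), (Pairwise fun i j => gromovProduct p (a i) (a j) ≤ C) →
      Pairwise fun i j => gromovProduct p q (a i) ≤ C + δ ∨ gromovProduct p q (a j) ≤ C + δ :=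
    fun {p} q hp i j hij => by
      change gromovProduct p q (a i) ≤ C + δ ∨ gromovProduct p q (a j) ≤ C + δ
      rw [gromovProduct_comm p q (a i)]
      exact hδ.gromovProduct_le_or_le (hp hij) q
  obtain ⟨i, hsi, hti⟩ := exists_and_of_pairwise_or (off t hs) (off s ht)
  linarith [gromovProduct_add_gromovProduct_swap s t (a i), dist_comm s t]

theorem IsHyperbolicWith.dist_smul_le_of_pairwise {G : Type*} [Group G] [MulAction G S]
    [IsIsometricSMul G S] (hδ : IsHyperbolicWith S δ) {s : S} {a : Fin 3 → S} {C : ℝ}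
    (hs : Pairwise fun i j => gromovProduct s (a i) (a j) ≤ C) (g : G)
    (hg : ∀ i, C + 2 * δ < gromovProduct s (a i) (g • a i)) :
    dist (g • s) s ≤ 2 * (C + 3 * δ) := by
  have hδ0 := hδ.nonneg s
  have hgs : Pairwise fun i j => gromovProduct (g⁻¹ • s) (a i) (a j) ≤ C + 2 * δ :=
    fun i j hij => by
      change gromovProduct (g⁻¹ • s) (a i) (a j) ≤ C + 2 * δ
      rw [gromovProduct_smul_base, inv_inv]
      rcases hδ.gromovProduct_le_or_le (hs hij) (g • a i) with h | h
      · linarith [hg i]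
      rcases hδ.gromovProduct_le_or_le h (g • a j) with h | h
      · linarith
      · linarith [hg j, gromovProduct_comm s (a j) (g • a j)]
  have h := hδ.dist_le_of_pairwise (hs.mono fun i j hij => by linarith) hgs
  rw [← dist_smul g, smul_inv_smul] at h
  linarith

end FourPoint

/-! ### Sequences converging at infinity -/

section Sequences

variable {S : Type*} [MetricSpace S]

theorem asymptoticSeq_iff_tendsto (s : S) {x y : ℕ → S} :
    AsymptoticSeq x y ↔
      Tendsto (fun p : ℕ × ℕ => gromovProduct s (x p.1) (y p.2)) atTop atTop := by
  refine ⟨fun h => h s, fun h t => ?_⟩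
  refine tendsto_atTop_mono (fun p => ?_) (tendsto_atTop_add_const_right _ (-dist s t) h)
  linarith [gromovProduct_le_add_dist_base s t (x p.1) (y p.2)]

theorem ConvergesAtInfinity.tendsto_dist {x : ℕ → S} (hx : ConvergesAtInfinity x) (s : S) :
    Tendsto (fun n => dist (x n) s) atTop atTop := by
  simpa only [Function.comp_def, gromovProduct_self] using (hx s).comp tendsto_atTop_diagonal

theorem ConvergesAtInfinity.asymptoticSeq_comp {x : ℕ → S} (hx : ConvergesAtInfinity x)
    {φ : ℕ → ℕ} (hφ : Tendsto φ atTop atTop) : AsymptoticSeq x (x ∘ φ) :=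
  fun s => (hx s).comp (tendsto_id.prod_atTop hφ)

/-- The points `y n` are seen from `s` in pairwise different directions, uniformly so: their
Gromov products at `s` are at most `C`. -/
def SeparatedDirections (s : S) (C : ℝ) (y : ℕ → S) : Prop :=
  Pairwise fun i j => gromovProduct s (y i) (y j) ≤ C

theorem exists_separatedDirections_comp {s : S} {y : ℕ → S} {l : Filter ℕ} [l.NeBot]
    (hl : l ≤ atTop) {C : ℝ} (h : ∀ i, ∀ᶠ j in l, gromovProduct s (y i) (y j) ≤ C) :
    ∃ φ : ℕ → ℕ, Tendsto φ atTop atTop ∧ SeparatedDirections s C (y ∘ φ) := by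
  let r : ℕ → ℕ → Prop := fun i j => i ≠ j ∧ gromovProduct s (y i) (y j) ≤ C
  have hr : Std.Symm r := ⟨fun i j hij => ⟨hij.1.symm, gromovProduct_comm s _ _ ▸ hij.2⟩⟩
  obtain ⟨φ, -, hφ⟩ := exists_seq_of_forall_finset_exists' (fun _ => True) r fun F _ => by
    obtain ⟨j, hj⟩ := ((Finset.eventually_all F).2 fun i _ =>
      ((eventually_ne_atTop i).filter_mono hl).and (h i)).exists
    exact ⟨j, trivial, fun i hi => ⟨(hj i hi).1.symm, (hj i hi).2⟩⟩
  have hinj : Function.Injective φ := fun i j hij => by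
    by_contra hne
    exact (hφ hne).1 hij
  exact ⟨φ, hinj.nat_tendsto_atTop, hφ.mono fun i j hij => hij.2⟩

variable [GromovHyperbolic S]

theorem ConvergesAtInfinity.asymptoticSeq_of_tendsto {x y : ℕ → S} (hx : ConvergesAtInfinity x)
    {s : S} (h : Tendsto (fun n => gromovProduct s (x n) (y n)) atTop atTop) :
    AsymptoticSeq x y := by
  obtain ⟨δ, hδ⟩ := exists_isHyperbolicWith S
  refine (asymptoticSeq_iff_tendsto s).2 (tendsto_atTop.2 fun M => ?_)
  have hsnd : Tendsto (Prod.snd : ℕ × ℕ → ℕ) atTop atTop := by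
    rw [← prod_atTop_atTop_eq]
    exact tendsto_snd
  filter_upwards [(hx s).eventually_ge_atTop (M + δ),
    (h.comp hsnd).eventually_ge_atTop (M + δ)] with p hxx hxy
  linarith [hδ.sub_le_gromovProduct hxx hxy]

theorem exists_convergesAtInfinity_comp {s : S} {y : ℕ → S} {l : Filter ℕ} [l.NeBot]
    (hl : l ≤ atTop) (h : ∀ C : ℝ, ∃ i, ∀ᶠ j in l, C < gromovProduct s (y i) (y j)) :
    ∃ φ : ℕ → ℕ, Tendsto φ atTop atTop ∧ ConvergesAtInfinity (y ∘ φ) := by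
  obtain ⟨δ, hδ⟩ := exists_isHyperbolicWith S
  choose c hc using fun n : ℕ => h n
  obtain ⟨φ, hφ, hcφ⟩ := extraction_forall_of_frequently
    (P := fun n k => ∀ m ∈ Set.Iic n, (m : ℝ) < gromovProduct s (y (c m)) (y k)) fun n =>
      (((Set.finite_Iic n).eventually_all (l := l)).2 fun m _ => hc m).frequently.filter_mono hl
  refine ⟨φ, hφ.tendsto_atTop, (asymptoticSeq_iff_tendsto s).2 (tendsto_atTop.2 fun M => ?_)⟩
  obtain ⟨N, hN⟩ := exists_nat_ge (M + δ)
  filter_upwards [eventually_ge_atTop (N, N)] with p hp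
  have h₁ := hcφ p.1 N hp.1
  rw [gromovProduct_comm] at h₁
  exact (by linarith : M ≤ N - δ).trans (hδ.sub_le_gromovProduct h₁.le (hcφ p.2 N hp.2).le)

/-- The substitute for compactness of `S ∪ ∂S`, which holds only for proper `S`. -/
theorem exists_comp_converges_or_separatedDirections (s : S) (y : ℕ → S) :
    ∃ φ : ℕ → ℕ, Tendsto φ atTop atTop ∧
      (ConvergesAtInfinity (y ∘ φ) ∨ ∃ C, SeparatedDirections s C (y ∘ φ)) := by
  by_cases h : ∀ C : ℝ, ∃ i, ∀ᶠ j in hyperfilter ℕ, C < gromovProduct s (y i) (y j)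
  · obtain ⟨φ, hφ, hy⟩ := exists_convergesAtInfinity_comp Nat.hyperfilter_le_atTop h
    exact ⟨φ, hφ, Or.inl hy⟩
  · push Not at h
    obtain ⟨C, hC⟩ := h
    obtain ⟨φ, hφ, hy⟩ := exists_separatedDirections_comp (C := C) (s := s) (y := y)
      Nat.hyperfilter_le_atTop fun i => by
        simpa only [Ultrafilter.frequently_iff_eventually] using hC i
    exact ⟨φ, hφ, Or.inr ⟨C, hy⟩⟩

end Sequences

/-! ### Boundary points -/

section Boundary

variable {S : Type*} [MetricSpace S] [GromovHyperbolic S]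

theorem GromovBoundary.exists_converges (ξ : GromovBoundary S) :
    ∃ x : ℕ → S, ConvergesToBoundary x ξ := by
  induction ξ using Quotient.inductionOn with
  | _ x => exact ⟨x.1, x.2, rfl⟩

theorem ConvergesToBoundary.asymptoticSeq {x y : ℕ → S} {ξ : GromovBoundary S}
    (hx : ConvergesToBoundary x ξ) (hy : ConvergesToBoundary y ξ) : AsymptoticSeq x y := by
  obtain ⟨hx, rfl⟩ := hx
  obtain ⟨hy, h⟩ := hy
  exact (Quotient.exact (s := gromovSetoid S) h).symm

theorem ConvergesToBoundary.of_asymptoticSeq {x y : ℕ → S} {ξ : GromovBoundary S}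
    (hx : ConvergesToBoundary x ξ) (h : AsymptoticSeq x y) : ConvergesToBoundary y ξ := by
  obtain ⟨hx, rfl⟩ := hx
  exact ⟨h.symm.trans h, Quotient.sound (s := gromovSetoid S) h.symm⟩

theorem ConvergesToBoundary.eq_of_asymptoticSeq {x y : ℕ → S} {ξ η : GromovBoundary S}
    (hx : ConvergesToBoundary x ξ) (hy : ConvergesToBoundary y η) (h : AsymptoticSeq x y) :
    ξ = η := by
  obtain ⟨hx, rfl⟩ := hx
  obtain ⟨hy, rfl⟩ := hy
  exact Quotient.sound (s := gromovSetoid S) h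

theorem ConvergesToBoundary.comp {x : ℕ → S} {ξ : GromovBoundary S}
    (hx : ConvergesToBoundary x ξ) {φ : ℕ → ℕ} (hφ : Tendsto φ atTop atTop) :
    ConvergesToBoundary (x ∘ φ) ξ :=
  hx.of_asymptoticSeq (hx.1.asymptoticSeq_comp hφ)

theorem ConvergesToBoundary.of_tendsto {x y : ℕ → S} {ξ : GromovBoundary S}
    (hx : ConvergesToBoundary x ξ) {s : S}
    (h : Tendsto (fun n => gromovProduct s (x n) (y n)) atTop atTop) : ConvergesToBoundary y ξ :=
  hx.of_asymptoticSeq (hx.1.asymptoticSeq_of_tendsto h)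

theorem ConvergesToBoundary.of_dist_le {x y : ℕ → S} {ξ : GromovBoundary S}
    (hx : ConvergesToBoundary x ξ) {C : ℝ} (h : ∀ n, dist (x n) (y n) ≤ C) :
    ConvergesToBoundary y ξ := by
  refine hx.of_tendsto (s := x 0) (tendsto_atTop_mono (fun n => ?_)
    (tendsto_atTop_add_const_right _ (-C) (hx.1.tendsto_dist (x 0))))
  have := gromovProduct_le_add_dist_right (x 0) (x n) (x n) (y n)
  rw [gromovProduct_self] at this
  linarith [h n]

theorem ConvergesToBoundary.tendsto_gromovProduct {x y : ℕ → S} {ξ : GromovBoundary S}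
    (hx : ConvergesToBoundary x ξ) (hy : ConvergesToBoundary y ξ) (s : S) :
    Tendsto (fun n => gromovProduct s (x n) (y n)) atTop atTop :=
  (hx.asymptoticSeq hy s).comp tendsto_atTop_diagonal

/-- The Gromov product `(ξ, η)_s` of two boundary points is at most `C`, along all sequences
representing them. -/
def BoundaryProductLE (s : S) (C : ℝ) (ξ η : GromovBoundary S) : Prop :=
  ∀ x y : ℕ → S, ConvergesToBoundary x ξ → ConvergesToBoundary y η →
    ∀ᶠ p : ℕ × ℕ in atTop, gromovProduct s (x p.1) (y p.2) ≤ C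

theorem BoundaryProductLE.eventually {s : S} {C : ℝ} {ξ η : GromovBoundary S}
    (h : BoundaryProductLE s C ξ η) {x y : ℕ → S} (hx : ConvergesToBoundary x ξ)
    (hy : ConvergesToBoundary y η) : ∀ᶠ n in atTop, gromovProduct s (x n) (y n) ≤ C :=
  tendsto_atTop_diagonal.eventually (h x y hx hy)

theorem eventually_boundaryProductLE (s : S) {ξ η : GromovBoundary S} (h : ξ ≠ η) :
    ∀ᶠ C in atTop, BoundaryProductLE s C ξ η := by
  obtain ⟨δ, hδ⟩ := exists_isHyperbolicWith S
  obtain ⟨x, hx⟩ := ξ.exists_converges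
  obtain ⟨y, hy⟩ := η.exists_converges
  obtain ⟨M, hM⟩ : ∃ M, ∃ᶠ p : ℕ × ℕ in atTop, gromovProduct s (x p.1) (y p.2) < M := by
    have := mt (fun h => hx.eq_of_asymptoticSeq hy ((asymptoticSeq_iff_tendsto s).2 h)) h
    simpa only [tendsto_atTop, not_forall, not_eventually, not_le] using this
  filter_upwards [eventually_ge_atTop (M + 2 * δ)] with C hC x' y' hx' hy'
  obtain ⟨a, ha⟩ := eventually_atTop_prod_self'.1
    ((hx.asymptoticSeq hx' s).eventually_ge_atTop C)
  obtain ⟨b, hb⟩ := eventually_atTop_prod_self'.1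
    ((hy'.asymptoticSeq hy s).eventually_ge_atTop (C - δ))
  obtain ⟨q, hq, hqM⟩ := hM.forall_exists_of_atTop (a, b)
  filter_upwards [eventually_ge_atTop (a, b)] with p hp
  by_contra! hpC
  have h₁ := hδ.sub_le_gromovProduct (ha q.1 hq.1 p.1 hp.1) hpC.le
  have h₂ := hδ.sub_le_gromovProduct h₁ (hb p.2 hp.2 q.2 hq.2)
  linarith

theorem exists_pairwise_boundaryProductLE (s : S) {ι : Type*} [Finite ι]
    {ξ : ι → GromovBoundary S} (hξ : Function.Injective ξ) :
    ∃ C, Pairwise fun i j => BoundaryProductLE s C (ξ i) (ξ j) := by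
  have h : ∀ᶠ C in atTop, ∀ i j, i ≠ j → BoundaryProductLE s C (ξ i) (ξ j) :=
    eventually_all.2 fun i => eventually_all.2 fun j => eventually_imp_distrib_left.2 fun hij =>
      eventually_boundaryProductLE s (hξ.ne hij)
  obtain ⟨C, hC⟩ := h.exists
  exact ⟨C, fun i j => hC i j⟩

theorem eventually_pairwise_gromovProduct_le {s : S} {C : ℝ} {ι : Type*} [Finite ι]
    {ξ : ι → GromovBoundary S} (hξ : Pairwise fun i j => BoundaryProductLE s C (ξ i) (ξ j))
    {x : ι → ℕ → S} (hx : ∀ i, ConvergesToBoundary (x i) (ξ i)) :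
    ∀ᶠ n in atTop, Pairwise fun i j => gromovProduct s (x i n) (x j n) ≤ C :=
  eventually_all.2 fun i => eventually_all.2 fun j => eventually_imp_distrib_left.2 fun hij =>
    (hξ hij).eventually (hx i) (hx j)

theorem ConvergesToBoundary.eq_of_frequently {x y : ℕ → S} {ξ η : GromovBoundary S}
    (hx : ConvergesToBoundary x ξ) (hy : ConvergesToBoundary y η) {s : S}
    (h : ∀ M : ℝ, ∃ᶠ n in atTop, M < gromovProduct s (x n) (y n)) : ξ = η := by
  by_contra hne
  obtain ⟨C, hC⟩ := (eventually_boundaryProductLE s hne).exists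
  exact h C ((hC.eventually hx hy).mono fun n => not_lt.2)

/- Seen from a base point close to `ξ`, all points away from `ξ` lie in nearly the same direction,
that of `s`. -/
theorem ConvergesToBoundary.eventually_not_boundaryProductLE {z : ℕ → S}
    {ξ η η' : GromovBoundary S} (hz : ConvergesToBoundary z ξ) (hη : ξ ≠ η) (hη' : ξ ≠ η')
    (C : ℝ) : ∀ᶠ n in atTop, ¬ BoundaryProductLE (z n) C η η' := by
  obtain ⟨δ, hδ⟩ := exists_isHyperbolicWith S
  obtain ⟨x, hx⟩ := η.exists_converges
  obtain ⟨y, hy⟩ := η'.exists_converges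
  let s := z 0
  obtain ⟨K, hK, hK'⟩ := ((eventually_boundaryProductLE s hη).and
    (eventually_boundaryProductLE s hη')).exists
  filter_upwards [(hz.1.tendsto_dist s).eventually_gt_atTop (C + δ + K),
    eventually_atTop_curry (hK z x hz hx), eventually_atTop_curry (hK' z y hz hy)]
    with n hn hnx hny h
  obtain ⟨k, hkx, hky, hk⟩ := (hnx.and (hny.and (h.eventually hx hy))).exists
  have hx' := gromovProduct_add_gromovProduct_swap s (z n) (x k)
  have hy' := gromovProduct_add_gromovProduct_swap s (z n) (y k)
  rw [gromovProduct_comm (z n) s (x k)] at hx'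
  have := hδ.sub_le_gromovProduct (a := dist (z n) s - K)
    (show _ ≤ gromovProduct (z n) (x k) s by linarith)
    (show _ ≤ gromovProduct (z n) s (y k) by linarith)
  linarith

/-- The shadow of `z` at depth `r`, seen from `s`: the boundary points represented by sequences
with infinitely many terms whose Gromov product with `z` at `s` is at least `r`. Passing to a
subsequence, `infinitely many` may be read as `all but finitely many`. -/
def shadow (s z : S) (r : ℝ) : Set (GromovBoundary S) :=
  {ξ | ∃ x, ConvergesToBoundary x ξ ∧ ∃ᶠ n in atTop, r ≤ gromovProduct s z (x n)}

theorem shadow_antitone (s z : S) : Antitone (shadow s z) := fun _ _ hr _ ⟨x, hx, h⟩ =>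
  ⟨x, hx, h.mono fun _ => hr.trans⟩

theorem ConvergesToBoundary.eventually_mem_shadow {x : ℕ → S} {ξ : GromovBoundary S}
    (hx : ConvergesToBoundary x ξ) (s : S) (r : ℝ) : ∀ᶠ n in atTop, ξ ∈ shadow s (x n) r :=
  (eventually_atTop_curry ((hx.1 s).eventually_ge_atTop r)).mono fun _ hn =>
    ⟨x, hx, hn.frequently⟩

theorem IsHyperbolicWith.frequently_le_gromovProduct_of_mem_shadow {δ : ℝ}
    (hδ : IsHyperbolicWith S δ) {s z : S} {r : ℝ} {ξ : GromovBoundary S} (hξ : ξ ∈ shadow s z r)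
    {y : ℕ → S} (hy : ConvergesToBoundary y ξ) :
    ∃ᶠ n in atTop, r - δ ≤ gromovProduct s z (y n) := by
  obtain ⟨x, hx, hxr⟩ := hξ
  exact (hxr.and_eventually ((hx.tendsto_gromovProduct hy s).eventually_ge_atTop r)).mono
    fun n hn => hδ.sub_le_gromovProduct hn.1 hn.2

end Boundary

/-! ### Isometric actions on the boundary -/

section Elliptic

variable {G S : Type*} [Group G] [MetricSpace S] [MulAction G S] [IsIsometricSMul G S]

theorem isElliptic_iff (s : S) {H : Subgroup G} :
    IsElliptic S H ↔ ∃ C : ℝ, ∀ h ∈ H, dist (h • s) s ≤ C := by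
  constructor
  · intro h
    obtain ⟨C, hC⟩ := Metric.isBounded_iff.1 (h s)
    exact ⟨C, fun g hg => hC ⟨g, hg, rfl⟩ ⟨1, H.one_mem, (one_smul G s).symm⟩⟩
  · rintro ⟨C, hC⟩ t
    refine (Metric.isBounded_iff_subset_closedBall s).2 ⟨C + dist t s, ?_⟩
    rintro _ ⟨h, hh, rfl⟩
    rw [Metric.mem_closedBall]
    have := dist_triangle (h • t) (h • s) s
    rw [dist_smul] at this
    linarith [hC h hh]

theorem dist_smul_smul_smul_eq_dist_conj_smul (g h : G) (s : S) :
    dist (h • g • s) (g • s) = dist ((g⁻¹ * h * g) • s) s := by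
  rw [← dist_smul g⁻¹, inv_smul_smul, mul_smul, mul_smul]

theorem SeparatedDirections.exists_gromovProduct_smul_le [GromovHyperbolic S] {s : S} {C : ℝ}
    {y : ℕ → S} (hy : SeparatedDirections s C y) {H : Subgroup G} (hH : ¬ IsElliptic S H) :
    ∃ p ∈ H, ∃ C' : ℝ, ∀ᶠ n in atTop, gromovProduct s (y n) (p • y n) ≤ C' := by
  obtain ⟨δ, hδ⟩ := exists_isHyperbolicWith S
  rw [isElliptic_iff s] at hH
  push Not at hH
  obtain ⟨p, hp, hps⟩ := hH (2 * (C + 3 * δ))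
  refine ⟨p, hp, C + 2 * δ, ?_⟩
  by_contra hcon
  simp only [not_eventually, not_le] at hcon
  obtain ⟨φ, hφ, hpφ⟩ := extraction_of_frequently_atTop hcon
  refine hps.not_ge (hδ.dist_smul_le_of_pairwise (a := fun i : Fin 3 => y (φ i))
    (fun i j hij => hy (hφ.injective.ne (Fin.val_injective.ne hij))) p fun i => hpφ i)

end Elliptic

section LimitSet

variable {G S : Type*} [Group G] [MetricSpace S] [GromovHyperbolic S] [MulAction G S]

theorem limitSet_mono {H K : Subgroup G} (h : H ≤ K) : limitSet S H ⊆ limitSet S K :=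
  fun _ ⟨s, u, hu, hξ⟩ => ⟨s, u, fun n => h (hu n), hξ⟩

theorem mem_limitSet_of_frequently {x : ℕ → S} {ξ : GromovBoundary S}
    (hx : ConvergesToBoundary x ξ) {s : S} {H : Subgroup G}
    (hH : ∀ M : ℝ, ∃ᶠ n in atTop, ∃ h ∈ H, M ≤ gromovProduct s (x n) (h • s)) :
    ξ ∈ limitSet S H := by
  obtain ⟨φ, hφ, hHφ⟩ := extraction_forall_of_frequently fun n : ℕ => hH n
  choose h hh hle using hHφ
  exact ⟨s, h, hh, (hx.comp hφ.tendsto_atTop).of_tendsto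
    (tendsto_atTop_mono hle tendsto_natCast_atTop_atTop)⟩

end LimitSet

section BoundaryAction

variable {G S : Type*} [Group G] [MetricSpace S] [GromovHyperbolic S] [MulAction G S]
  [IsIsometricSMul G S]

theorem ConvergesToBoundary.smul (g : G) {x : ℕ → S} {ξ : GromovBoundary S}
    (hx : ConvergesToBoundary x ξ) : ConvergesToBoundary (fun n => g • x n) (g • ξ) := by
  obtain ⟨hx, rfl⟩ := hx
  exact ⟨AsymptoticSeq.smul g hx, rfl⟩

theorem BoundaryProductLE.smul (g : G) {s : S} {C : ℝ} {ξ η : GromovBoundary S}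
    (h : BoundaryProductLE s C ξ η) : BoundaryProductLE (g • s) C (g • ξ) (g • η) := by
  intro x y hx hy
  have hx' := hx.smul g⁻¹
  have hy' := hy.smul g⁻¹
  rw [inv_smul_smul] at hx' hy'
  simpa only [gromovProduct_smul_base] using h _ _ hx' hy'

theorem mem_limitSet_iff (s : S) {H : Subgroup G} {ξ : GromovBoundary S} :
    ξ ∈ limitSet S H ↔
      ∃ h : ℕ → G, (∀ n, h n ∈ H) ∧ ConvergesToBoundary (fun n => h n • s) ξ := by
  constructor
  · rintro ⟨t, h, hH, hξ⟩
    exact ⟨h, hH, hξ.of_dist_le fun n => (dist_smul (h n) t s).le⟩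
  · rintro ⟨h, hH, hξ⟩
    exact ⟨s, h, hH, hξ⟩

theorem smul_mem_limitSet {H : Subgroup G} {g : G} (hg : g ∈ H) {ξ : GromovBoundary S}
    (hξ : ξ ∈ limitSet S H) : g • ξ ∈ limitSet S H := by
  obtain ⟨s, h, hh, hξ⟩ := hξ
  exact ⟨s, fun n => g * h n, fun n => H.mul_mem hg (hh n), by
    simpa only [mul_smul] using hξ.smul g⟩

theorem fixesNoBoundaryPoint_iff {H : Subgroup G} :
    FixesNoBoundaryPoint S H ↔ ∀ ξ : GromovBoundary S, ¬ H ≤ MulAction.stabilizer G ξ := by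
  simp only [FixesNoBoundaryPoint, SetLike.not_le_iff_exists, MulAction.mem_stabilizer_iff]

theorem isElliptic_of_le_stabilizer {H : Subgroup G} {ξ : Fin 3 → GromovBoundary S}
    (hξ : Function.Injective ξ) (hH : ∀ i, H ≤ MulAction.stabilizer G (ξ i)) :
    IsElliptic S H := by
  obtain ⟨δ, hδ⟩ := exists_isHyperbolicWith S
  choose x hx using fun i => (ξ i).exists_converges
  let s := x 0 0
  obtain ⟨C, hC⟩ := exists_pairwise_boundaryProductLE s hξ
  refine (isElliptic_iff s).2 ⟨2 * (C + δ), fun h hh => ?_⟩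
  have hCh : Pairwise fun i j => BoundaryProductLE (h • s) C (ξ i) (ξ j) := fun i j hij => by
    have hij' := (hC hij).smul h
    rwa [hH i hh, hH j hh] at hij'
  obtain ⟨n, hn, hn'⟩ := ((eventually_pairwise_gromovProduct_le hCh hx).and
    (eventually_pairwise_gromovProduct_le hC hx)).exists
  exact hδ.dist_le_of_pairwise hn hn'

theorem IsElliptic.smul_eq_of_frequently_conj_mem {H : Subgroup G} (hH : IsElliptic S H)
    {g : ℕ → G} {s : S} {ξ : GromovBoundary S} (hg : ConvergesToBoundary (fun n => g n • s) ξ)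
    {k : G} (hk : ∃ᶠ n in atTop, (g n)⁻¹ * k * g n ∈ H) : k • ξ = ξ := by
  obtain ⟨C, hC⟩ := (isElliptic_iff s).1 hH
  refine (hg.eq_of_frequently (hg.smul k) (s := s) fun M => ?_).symm
  refine (hk.and_eventually ((hg.1.tendsto_dist s).eventually_gt_atTop (M + C))).mono
    fun n hn => ?_
  have hnear := hC _ hn.1
  rw [← dist_smul_smul_smul_eq_dist_conj_smul, dist_comm] at hnear
  have := gromovProduct_le_add_dist_right s (g n • s) (g n • s) (k • g n • s)
  rw [gromovProduct_self] at this
  linarith [hn.2]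

theorem isElliptic_fixingSubgroup {Ξ : Set (GromovBoundary S)} (hΞ : Ξ.Infinite) :
    IsElliptic S (fixingSubgroup G Ξ) :=
  have := hΞ.to_subtype
  isElliptic_of_le_stabilizer
    (Subtype.val_injective.comp ((Infinite.natEmbedding Ξ).injective.comp Fin.val_injective))
    fun i _ hg => hg (Infinite.natEmbedding Ξ i)

theorem normal_ellipticRadical : (ellipticRadical G S).Normal where
  conj_mem n hn g := by
    rw [ellipticRadical, mem_fixingSubgroup_iff] at hn ⊢
    intro ξ hξ
    rw [mul_smul, mul_smul, hn _ (smul_mem_limitSet (Subgroup.mem_top g⁻¹) hξ), smul_inv_smul]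

theorem isGreatest_ellipticRadical (hG : (limitSet S (⊤ : Subgroup G)).Infinite) :
    IsGreatest {N : Subgroup G | N.Normal ∧ IsElliptic S N} (ellipticRadical G S) := by
  refine ⟨⟨normal_ellipticRadical, isElliptic_fixingSubgroup hG⟩, ?_⟩
  rintro N ⟨hN, hell⟩ n hn
  rw [ellipticRadical, mem_fixingSubgroup_iff]
  rintro ξ ⟨s, g, -, hg⟩
  exact hell.smul_eq_of_frequently_conj_mem hg
    (Frequently.of_forall fun k => hN.conj_mem' n hn (g k))

theorem IsGeneralType.infinite_orbit (hG : IsGeneralType G S) (η : GromovBoundary S) :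
    (MulAction.orbit G η).Infinite := by
  intro hfin
  obtain ⟨k, -, hk⟩ := hG.2 η
  obtain ⟨ξ, ⟨s, g, -, hg⟩, hξ⟩ := (hG.1.sdiff hfin).nonempty
  have := hfin.to_subtype
  obtain ⟨C, hC⟩ := exists_pairwise_boundaryProductLE s
    (Subtype.val_injective (p := (· ∈ MulAction.orbit G η)))
  obtain ⟨n, hn⟩ := (hg.eventually_not_boundaryProductLE
    (fun h => hξ (h ▸ MulAction.mem_orbit η k))
    (fun h => hξ (h ▸ MulAction.mem_orbit_self η)) C).exists
  have hne : (g n)⁻¹ • k • η ≠ (g n)⁻¹ • η := (MulAction.injective _).ne hk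
  have := (@hC ⟨_, MulAction.mem_orbit_of_mem_orbit _ (MulAction.mem_orbit η k)⟩
    ⟨_, MulAction.mem_orbit η (g n)⁻¹⟩ (Subtype.coe_ne_coe.1 hne)).smul (g n)
  rw [smul_inv_smul, smul_inv_smul] at this
  exact hn this

end BoundaryAction

section Shadow

variable {G S : Type*} [Group G] [MetricSpace S] [GromovHyperbolic S] [MulAction G S]
  [IsIsometricSMul G S] {δ : ℝ}

theorem IsHyperbolicWith.exists_mem_of_mem_shadow (hδ : IsHyperbolicWith S δ) {s z : S} {r : ℝ}
    {ξ : GromovBoundary S} (hξ : ξ ∈ shadow s z r) {H : Subgroup G} (hH : ξ ∈ limitSet S H) :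
    ∃ h ∈ H, r - δ ≤ gromovProduct s z (h • s) := by
  obtain ⟨h, hh, hhξ⟩ := (mem_limitSet_iff s).1 hH
  obtain ⟨n, hn⟩ := (hδ.frequently_le_gromovProduct_of_mem_shadow hξ hhξ).exists
  exact ⟨h n, hh n, hn⟩

theorem IsHyperbolicWith.le_gromovProduct_smul_of_mem_shadow (hδ : IsHyperbolicWith S δ)
    {s z : S} {r : ℝ} {ξ : GromovBoundary S} (hξ : ξ ∈ shadow s z r) {h : G} (hh : h • ξ = ξ) :
    r - dist (h • s) s - 2 * δ ≤ gromovProduct s z (h • z) := by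
  obtain ⟨x, hx, hxr⟩ := hξ
  have hhx := hx.smul h
  rw [hh] at hhx
  obtain ⟨n, hzx, hxhx⟩ := (hxr.and_eventually
    ((hx.tendsto_gromovProduct hhx s).eventually_ge_atTop r)).exists
  have hz_hx := hδ.sub_le_gromovProduct hzx hxhx
  have hhx_hz : r - dist (h • s) s ≤ gromovProduct s (h • x n) (h • z) := by
    have := gromovProduct_le_add_dist_base (h • s) s (h • x n) (h • z)
    rw [gromovProduct_smul, gromovProduct_comm s (x n)] at this
    linarith
  have := hδ.sub_le_gromovProduct (a := r - dist (h • s) s - δ)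
    (by linarith [dist_nonneg (x := h • s) (y := s)]) (by linarith [hδ.nonneg s] :
      _ ≤ gromovProduct s (h • x n) (h • z))
  linarith

theorem ConvergesToBoundary.smul_mem_shadow {x : ℕ → S} {ζ : GromovBoundary S}
    (hx : ConvergesToBoundary x ζ) {g : G} {s : S} {C : ℝ}
    (h : ∃ᶠ k in atTop, gromovProduct s (x k) (g⁻¹ • s) ≤ C) :
    g • ζ ∈ shadow s (g • s) (dist (g • s) s - C) := by
  refine ⟨_, hx.smul g, h.mono fun k hk => ?_⟩
  rw [gromovProduct_smul_right]
  linarith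

/- North-south dynamics: `g n` pushes every boundary point except the limit of `(g n)⁻¹ • s` into
deep shadows of `g n • s`. -/
theorem ConvergesToBoundary.exists_smul_mem_shadow {g : ℕ → G} {s : S} {η ζ : GromovBoundary S}
    (hg : ConvergesToBoundary (fun n => (g n)⁻¹ • s) η) (hζ : ζ ≠ η) :
    ∃ C : ℝ, ∀ᶠ n in atTop, g n • ζ ∈ shadow s (g n • s) (dist (g n • s) s - C) := by
  obtain ⟨x, hx⟩ := ζ.exists_converges
  obtain ⟨C, hC⟩ := (eventually_boundaryProductLE s hζ.symm).exists
  refine ⟨C, (eventually_atTop_curry (hC _ x hg hx)).mono fun n hn =>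
    hx.smul_mem_shadow (hn.frequently.mono fun k hk => ?_)⟩
  rwa [gromovProduct_comm]

theorem SeparatedDirections.exists_smul_mem_shadow {g : ℕ → G} {s : S} {C : ℝ}
    (hg : SeparatedDirections s C fun n => (g n)⁻¹ • s) (ζ : GromovBoundary S) :
    ∃ C' : ℝ, ∀ᶠ n in atTop, g n • ζ ∈ shadow s (g n • s) (dist (g n • s) s - C') := by
  obtain ⟨δ, hδ⟩ := exists_isHyperbolicWith S
  obtain ⟨x, hx⟩ := ζ.exists_converges
  have hbad : {n | ∀ᶠ k in atTop, C + δ < gromovProduct s (x k) ((g n)⁻¹ • s)}.Subsingleton := by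
    intro i hi j hj
    by_contra hij
    obtain ⟨k, hki, hkj⟩ := (hi.and hj).exists
    rw [gromovProduct_comm] at hki
    rcases hδ.gromovProduct_le_or_le (hg hij) (x k) with h | h <;> linarith
  refine ⟨C + δ, ?_⟩
  rw [← Nat.cofinite_eq_atTop]
  refine hbad.finite.eventually_cofinite_notMem.mono fun n hn => hx.smul_mem_shadow ?_
  simpa only [Set.mem_ofPred_eq, not_eventually, not_lt] using hn

theorem ConvergesToBoundary.exists_gromovProduct_smul_le {y : ℕ → S} {η : GromovBoundary S}
    (hy : ConvergesToBoundary y η) (s : S) {H : Subgroup G}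
    (hH : ¬ H ≤ MulAction.stabilizer G η) :
    ∃ p ∈ H, ∃ C : ℝ, ∀ᶠ n in atTop, gromovProduct s (y n) (p • y n) ≤ C := by
  obtain ⟨p, hp, hpη⟩ := SetLike.not_le_iff_exists.1 hH
  obtain ⟨C, hC⟩ := (eventually_boundaryProductLE s (Ne.symm hpη)).exists
  exact ⟨p, hp, C, hC.eventually hy (hy.smul p)⟩

theorem ConvergesToBoundary.le_stabilizer_of_frequently {g : ℕ → G} {s : S}
    {ξ : GromovBoundary S} (hg : ConvergesToBoundary (fun n => g n • s) ξ) {H : Subgroup G} {C : ℝ}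
    (hfreq : ∃ᶠ n in atTop, ∀ h ∈ H,
      dist (g n • s) s - C - dist (h • s) s ≤ gromovProduct s (g n • s) (h • g n • s)) :
    H ≤ MulAction.stabilizer G ξ := by
  refine fun k hk => (hg.eq_of_frequently (hg.smul k) (s := s) fun M => ?_).symm
  refine (hfreq.and_eventually ((hg.1.tendsto_dist s).eventually_gt_atTop
    (M + C + dist (k • s) s))).mono fun n hn => ?_
  linarith [hn.1 k hk, hn.2]

theorem exists_seq_of_mem_limitSet (s : S) {ξ : GromovBoundary S} {H : Subgroup G}
    (hξ : ξ ∈ limitSet S H) :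
    ∃ g : ℕ → G, ConvergesToBoundary (fun n => g n • s) ξ ∧
      ((∃ η, ConvergesToBoundary (fun n => (g n)⁻¹ • s) η) ∨
        ∃ C, SeparatedDirections s C fun n => (g n)⁻¹ • s) := by
  obtain ⟨g, -, hg⟩ := (mem_limitSet_iff s).1 hξ
  obtain ⟨φ, hφ, h⟩ := exists_comp_converges_or_separatedDirections s fun n => (g n)⁻¹ • s
  exact ⟨g ∘ φ, hg.comp hφ, h.imp_left fun h => ⟨_, h, rfl⟩⟩

theorem exists_countable_subset_limitSet [Countable G] [Nonempty S] (K : Subgroup G) :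
    ∃ Ξ ⊆ limitSet S K, Ξ.Countable ∧ ∀ H ≤ K, Ξ ⊆ limitSet S H → limitSet S H = limitSet S K := by
  obtain ⟨δ, hδ⟩ := exists_isHyperbolicWith S
  let s : S := Classical.arbitrary S
  let T : Set (G × ℕ) := {p | (limitSet S K ∩ shadow s (p.1 • s) p.2).Nonempty}
  choose ξ hξK hξs using fun p : T => p.2
  refine ⟨Set.range ξ, Set.range_subset_iff.2 hξK, Set.countable_range ξ, fun H hHK hH =>
    (limitSet_mono hHK).antisymm fun ζ hζ => ?_⟩
  obtain ⟨g, -, hg⟩ := (mem_limitSet_iff s).1 hζ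
  refine mem_limitSet_of_frequently hg (s := s) fun M => ?_
  obtain ⟨k, hk⟩ := exists_nat_ge (M + δ)
  refine ((hg.eventually_mem_shadow s k).mono fun n hn => ?_).frequently
  let p : T := ⟨(g n, k), ζ, hζ, hn⟩
  obtain ⟨h, hh, hle⟩ := hδ.exists_mem_of_mem_shadow (hξs p) (hH ⟨p, rfl⟩)
  exact ⟨h, hh, (le_sub_iff_add_le.2 hk).trans hle⟩

end Shadow

section Recurrence

variable {M α : Type*} [SMul M α] [MeasurableSpace α] {μ : Measure α} [SMulInvariantMeasure M α μ]

theorem smulInvariantMeasure_restrict {E : Set α} (hE : MeasurableSet E)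
    (hinv : ∀ (c : M) (x : α), c • x ∈ E ↔ x ∈ E) :
    SMulInvariantMeasure M α (μ.restrict E) where
  measure_preimage_smul c A hA := by
    have hpre : (c • ·) ⁻¹' A ∩ E = (c • ·) ⁻¹' (A ∩ E) := by
      ext x
      simp [hinv]
    rw [Measure.restrict_apply' hE, Measure.restrict_apply hA, hpre]
    exact SMulInvariantMeasure.measure_preimage_smul c (hA.inter hE)

variable [IsFiniteMeasure μ] {g : ℕ → M}

theorem measure_le_measure_frequently_mem {A : ℕ → Set α} (hA : ∀ n, MeasurableSet (A n))
    {D : Set α} (hD : ∀ᶠ n in atTop, ∀ x ∈ D, g n • x ∈ A n) :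
    μ D ≤ μ {x | ∃ᶠ n in atTop, x ∈ A n} := by
  have hlimsup : {x | ∃ᶠ n in atTop, x ∈ A n} = ⋂ N, ⋃ n ≥ N, A n := by
    ext x
    simp [frequently_atTop]
  have hanti : Antitone fun N => ⋃ n ≥ N, A n := fun N N' h =>
    Set.biUnion_mono (fun n hn => h.trans hn) fun _ _ => subset_rfl
  rw [hlimsup, hanti.measure_iInter
    (fun N => (MeasurableSet.biUnion (Set.to_countable _) fun n _ => hA n).nullMeasurableSet)
    ⟨0, measure_ne_top _ _⟩]
  refine le_iInf fun N => ?_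
  obtain ⟨n, hDn, hn⟩ := (hD.and (eventually_ge_atTop N)).exists
  calc μ D ≤ μ ((g n • ·) ⁻¹' A n) := measure_mono hDn
    _ = μ (A n) := SMulInvariantMeasure.measure_preimage_smul _ (hA n)
    _ ≤ μ (⋃ n ≥ N, A n) := measure_mono (Set.subset_biUnion_of_mem (u := A) hn)

theorem ae_notMem_of_ae_not_frequently_mem {A : ℕ → Set α} (hA : ∀ n, MeasurableSet (A n))
    {D : Set α} (hD : ∀ᶠ n in atTop, ∀ x ∈ D, g n • x ∈ A n)
    (h : ∀ᵐ x ∂μ, ¬ ∃ᶠ n in atTop, x ∈ A n) : ∀ᵐ x ∂μ, x ∉ D := by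
  rw [← measure_eq_zero_iff_ae_notMem, ← nonpos_iff_eq_zero]
  exact (measure_le_measure_frequently_mem hA hD).trans_eq
    (measure_eq_zero_iff_ae_notMem.2 h)

theorem ae_exists_frequently_mem {A : ℕ → ℕ → Set α} (hA : ∀ R n, MeasurableSet (A R n))
    {D : ℕ → Set α} (hmono : Monotone D) (hD : ∀ R, ∀ᶠ n in atTop, ∀ x ∈ D R, g n • x ∈ A R n)
    (h : ∀ᵐ x ∂μ, ∃ R, x ∈ D R) : ∀ᵐ x ∂μ, ∃ R, ∃ᶠ n in atTop, x ∈ A R n := by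
  have hmeas : MeasurableSet {x | ∃ R, ∃ᶠ n in atTop, x ∈ A R n} := by
    simp only [← mem_limsup_iff_frequently_mem, Set.ofPred_exists]
    exact MeasurableSet.iUnion fun R => MeasurableSet.measurableSet_limsup (hA R)
  rw [ae_iff_measure_eq hmeas.nullMeasurableSet]
  refine (measure_mono (Set.subset_univ _)).antisymm ?_
  calc μ Set.univ = μ (⋃ R, D R) :=
        measure_congr (eventuallyEq_univ.2 (h.mono fun x hx => Set.mem_iUnion.2 hx)).symm
    _ = ⨆ R, μ (D R) := hmono.measure_iUnion
    _ ≤ μ {x | ∃ R, ∃ᶠ n in atTop, x ∈ A R n} := iSup_le fun R =>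
        (measure_le_measure_frequently_mem (hA R) (hD R)).trans
          (measure_mono fun x hx => ⟨R, hx⟩)

end Recurrence

theorem exists_nat_forall_ge_of_eventually {P : ℕ → ℝ → Prop} (hP : ∀ n, Monotone (P n)) {C : ℝ}
    (h : ∀ᶠ n in atTop, P n C) : ∃ R : ℕ, ∀ n ≥ R, P n R := by
  obtain ⟨N, hN⟩ := eventually_atTop.1 h
  obtain ⟨R, hR⟩ := exists_nat_ge C
  refine ⟨max N R, fun n hn => hP n (hR.trans ?_) (hN n (le_of_max_le_left hn))⟩
  exact_mod_cast le_max_right N R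

/-! ### The space of subgroups -/

section SubgroupSpace

open ConjAct

variable {G : Type*} [Group G]

theorem measurable_mem_subgroup (g : G) : Measurable fun H : Subgroup G => g ∈ H := by
  classical
  have : BorelSpace (Subgroup G) := ⟨rfl⟩
  have hcont : Continuous fun (H : Subgroup G) (k : G) => decide (k ∈ H) := by
    convert continuous_induced_dom
  have hopen : IsOpen {H : Subgroup G | decide (g ∈ H) = true} :=
    (isOpen_discrete {true}).preimage ((continuous_apply g).comp hcont)
  simpa only [decide_eq_true_eq] using measurableSet_setOfPred.1 hopen.measurableSet

theorem measurableSet_exists_mem [Countable G] (Q : G → Prop) :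
    MeasurableSet {H : Subgroup G | ∃ h ∈ H, Q h} :=
  measurableSet_setOfPred.2 (.exists fun h => (measurable_mem_subgroup h).and measurable_const)

theorem measurableSet_forall_mem [Countable G] (Q : G → Prop) :
    MeasurableSet {H : Subgroup G | ∀ h ∈ H, Q h} :=
  measurableSet_setOfPred.2 (.forall fun h => (measurable_mem_subgroup h).imp measurable_const)

theorem mem_toConjAct_smul_iff {g h : G} {H : Subgroup G} :
    h ∈ toConjAct g • H ↔ g⁻¹ * h * g ∈ H := by
  rw [Subgroup.mem_pointwise_smul_iff_inv_smul_mem, ← toConjAct_inv, toConjAct_inv_smul]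

theorem conj_mem_toConjAct_smul_iff {g h : G} {H : Subgroup G} :
    g * h * g⁻¹ ∈ toConjAct g • H ↔ h ∈ H := by
  rw [← toConjAct_smul, Subgroup.smul_mem_pointwise_smul_iff]

theorem toConjAct_smul_le_stabilizer_smul_iff {X : Type*} [MulAction G X] {g : G} {x : X}
    {H : Subgroup G} :
    toConjAct g • H ≤ MulAction.stabilizer G (g • x) ↔ H ≤ MulAction.stabilizer G x := by
  rw [MulAction.stabilizer_smul_eq_stabilizer_map_conj]
  exact Subgroup.pointwise_smul_le_pointwise_smul_iff (a := toConjAct g)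

theorem smul_le_iff_of_normal {N : Subgroup G} (hN : N.Normal) (g : ConjAct G) (H : Subgroup G) :
    g • H ≤ N ↔ H ≤ N := by
  conv_lhs => rw [← hN.conjAct g, Subgroup.pointwise_smul_le_pointwise_smul_iff]

theorem IsIRS.smulInvariantMeasure {μ : Measure (Subgroup G)} (hμ : IsIRS μ) :
    SMulInvariantMeasure (ConjAct G) (Subgroup G) μ where
  measure_preimage_smul g A hA := hμ.invariant (ofConjAct g) A hA

theorem IsErgodicIRS.ae_or_ae_of_ae_or {μ : Measure (Subgroup G)} (hμ : IsErgodicIRS μ)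
    {p q : Subgroup G → Prop} (hq : MeasurableSet {H | q H})
    (hinv : ∀ (g : ConjAct G) (H : Subgroup G), q (g • H) ↔ q H) (h : ∀ᵐ H ∂μ, p H ∨ q H) :
    (∀ᵐ H ∂μ, p H) ∨ ∀ᵐ H ∂μ, q H := by
  have := hμ.isProbabilityMeasure
  refine (hμ.ergodic _ hq fun g => Set.ext fun H => hinv (toConjAct g) H).imp (fun h0 => ?_)
    fun h1 => (mem_ae_iff_prob_eq_one hq).2 h1
  filter_upwards [h, measure_eq_zero_iff_ae_notMem.1 h0] with H hpq hq' using hpq.resolve_right hq'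

section Elliptic

variable {S : Type*} [MetricSpace S] [MulAction G S] [IsIsometricSMul G S]

theorem measurableSet_isElliptic [Countable G] [Nonempty S] :
    MeasurableSet {H : Subgroup G | IsElliptic S H} := by
  let s : S := Classical.arbitrary S
  have : {H : Subgroup G | IsElliptic S H} = ⋃ C : ℕ, {H | ∀ h ∈ H, dist (h • s) s ≤ C} := by
    ext H
    simp only [Set.mem_iUnion, Set.mem_ofPred_eq, isElliptic_iff s]
    refine ⟨fun ⟨C, hC⟩ => ?_, fun ⟨C, hC⟩ => ⟨C, hC⟩⟩
    obtain ⟨n, hn⟩ := exists_nat_ge C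
    exact ⟨n, fun h hh => (hC h hh).trans hn⟩
  rw [this]
  exact .iUnion fun C => measurableSet_forall_mem _

theorem IsElliptic.smul {H : Subgroup G} (hH : IsElliptic S H) (g : ConjAct G) :
    IsElliptic S (g • H) := by
  intro s
  obtain ⟨C, hC⟩ := (isElliptic_iff ((ofConjAct g)⁻¹ • s)).1 hH
  refine (isElliptic_iff s).2 ⟨C, fun h hh => ?_⟩ s
  have := hC _ (mem_toConjAct_smul_iff (g := ofConjAct g).1 hh)
  rwa [mul_smul, mul_smul, smul_inv_smul, dist_smul] at this

theorem isElliptic_smul_iff {H : Subgroup G} (g : ConjAct G) :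
    IsElliptic S (g • H) ↔ IsElliptic S H :=
  ⟨fun h => by simpa using h.smul g⁻¹, fun h => h.smul g⟩

end Elliptic

end SubgroupSpace

/-! ### Invariant random subgroups of groups acting on hyperbolic spaces -/

section RandomSubgroup

open ConjAct

variable {G S : Type*} [Group G] [Countable G] [MetricSpace S] [GromovHyperbolic S] [MulAction G S]
  [IsIsometricSMul G S] {μ : Measure (Subgroup G)} [IsFiniteMeasure μ]
  [SMulInvariantMeasure (ConjAct G) (Subgroup G) μ]

theorem ae_le_ellipticRadical (hell : ∀ᵐ H ∂μ, IsElliptic S H) :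
    ∀ᵐ H ∂μ, H ≤ ellipticRadical G S := by
  have hnotMem (k : G) (hk : k ∉ ellipticRadical G S) : ∀ᵐ H ∂μ, k ∉ H := by
    simp only [ellipticRadical, mem_fixingSubgroup_iff, not_forall] at hk
    obtain ⟨ξ, ⟨s, g, -, hg⟩, hkξ⟩ := hk
    refine ae_notMem_of_ae_not_frequently_mem (g := fun n => toConjAct (g n)⁻¹)
      (A := fun n => {H | (g n)⁻¹ * k * g n ∈ H}) (D := {H | k ∈ H})
      (fun n => measurableSet_setOfPred.2 (measurable_mem_subgroup _))
      (.of_forall fun n H hH => ?_)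
      (hell.mono fun H hH hfreq => hkξ (hH.smul_eq_of_frequently_conj_mem hg hfreq))
    simpa only [inv_inv, Set.mem_ofPred_eq] using conj_mem_toConjAct_smul_iff (g := (g n)⁻¹).2 hH
  filter_upwards [ae_all_iff.2 fun k => eventually_imp_distrib_left.2 (hnotMem k)] with H hH k
  exact not_imp_not.1 (hH k)

theorem ae_not_le_stabilizer (hell : ∀ᵐ H ∂μ, ¬ IsElliptic S H) {η : GromovBoundary S}
    (hη : (MulAction.orbit G η).Infinite) : ∀ᵐ H ∂μ, ¬ H ≤ MulAction.stabilizer G η := by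
  choose g hg using fun n => (hη.natEmbedding _ n).2
  have hinj : Function.Injective fun n => g n • η := fun m n h =>
    (hη.natEmbedding _).injective (Subtype.ext (by simpa only [hg] using h))
  refine ae_notMem_of_ae_not_frequently_mem (g := fun n => toConjAct (g n))
    (A := fun n => {H | H ≤ MulAction.stabilizer G (g n • η)})
    (D := {H | H ≤ MulAction.stabilizer G η}) (fun n => measurableSet_forall_mem _)
    (.of_forall fun n H hH => toConjAct_smul_le_stabilizer_smul_iff.2 hH) ?_
  refine hell.mono fun H hH hfreq => hH ?_
  obtain ⟨φ, hφ, hHφ⟩ := extraction_of_frequently_atTop hfreq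
  exact isElliptic_of_le_stabilizer (ξ := fun i : Fin 3 => g (φ i) • η)
    (hinj.comp (hφ.injective.comp Fin.val_injective)) fun i => hHφ i

theorem ae_exists_gromovProduct_smul_le (hG : IsGeneralType G S)
    (hell : ∀ᵐ H ∂μ, ¬ IsElliptic S H) {s : S} {y : ℕ → S}
    (hy : (∃ η, ConvergesToBoundary y η) ∨ ∃ C, SeparatedDirections s C y) :
    ∀ᵐ H ∂μ, ∃ p ∈ H, ∃ C : ℝ, ∀ᶠ n in atTop, gromovProduct s (y n) (p • y n) ≤ C := by
  rcases hy with ⟨η, hη⟩ | ⟨C, hC⟩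
  · exact (ae_not_le_stabilizer hell (hG.infinite_orbit η)).mono fun H hH =>
      hη.exists_gromovProduct_smul_le s hH
  · exact hell.mono fun H hH => hC.exists_gromovProduct_smul_le hH

theorem ae_mem_limitSet (hG : IsGeneralType G S) (hell : ∀ᵐ H ∂μ, ¬ IsElliptic S H)
    {ξ : GromovBoundary S} (hξ : ξ ∈ limitSet S (⊤ : Subgroup G)) :
    ∀ᵐ H ∂μ, ξ ∈ limitSet S H := by
  have ⟨s, _⟩ := hξ
  obtain ⟨g, hg, hy⟩ := exists_seq_of_mem_limitSet s hξ
  have hfreq : ∀ᵐ H ∂μ, ∃ R : ℕ, ∃ᶠ n in atTop,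
      ∃ h ∈ H, dist (g n • s) s - R ≤ gromovProduct s (g n • s) (h • s) := by
    refine ae_exists_frequently_mem (g := fun n => toConjAct (g n))
      (A := fun R n => {H | ∃ h ∈ H, dist (g n • s) s - R ≤ gromovProduct s (g n • s) (h • s)})
      (D := fun R => {H | ∃ p ∈ H, ∀ n ≥ R,
        gromovProduct s ((g n)⁻¹ • s) (p • (g n)⁻¹ • s) ≤ R})
      (fun R n => measurableSet_exists_mem _) ?_ ?_ ?_
    · exact fun R R' hR H ⟨p, hp, h⟩ =>
        ⟨p, hp, fun n hn => (h n (hR.trans hn)).trans (Nat.cast_le.2 hR)⟩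
    · intro R
      filter_upwards [eventually_ge_atTop R] with n hn H ⟨p, hp, h⟩
      refine ⟨g n * p * (g n)⁻¹, conj_mem_toConjAct_smul_iff.2 hp, ?_⟩
      rw [mul_smul, mul_smul, gromovProduct_smul_right, gromovProduct_comm]
      exact sub_le_sub_left (h n hn) _
    · filter_upwards [ae_exists_gromovProduct_smul_le hG hell hy] with H ⟨p, hp, C, hC⟩
      obtain ⟨R, hR⟩ := exists_nat_forall_ge_of_eventually
        (P := fun n C => gromovProduct s ((g n)⁻¹ • s) (p • (g n)⁻¹ • s) ≤ C)
        (fun n C C' hCC' h => le_trans h hCC') hC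
      exact ⟨R, p, hp, hR⟩
  filter_upwards [hfreq] with H ⟨R, hR⟩
  refine mem_limitSet_of_frequently hg (s := s) fun M => ?_
  refine (hR.and_eventually ((hg.1.tendsto_dist s).eventually_ge_atTop (M + R))).mono ?_
  exact fun n ⟨⟨h, hh, hle⟩, hn⟩ => ⟨h, hh, (le_sub_iff_add_le.2 hn).trans hle⟩

theorem ae_limitSet_eq (hG : IsGeneralType G S) (hell : ∀ᵐ H ∂μ, ¬ IsElliptic S H) :
    ∀ᵐ H ∂μ, limitSet S H = limitSet S (⊤ : Subgroup G) := by
  have : Nonempty S := ⟨hG.1.nonempty.choose_spec.choose⟩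
  obtain ⟨Ξ, hΞ, hcount, hdense⟩ := exists_countable_subset_limitSet (S := S) (⊤ : Subgroup G)
  filter_upwards [(ae_ball_iff hcount).2 fun ξ hξ => ae_mem_limitSet hG hell (hΞ hξ)] with H hH
  exact hdense H le_top hH

theorem ae_exists_smul_mem_shadow (hG : IsGeneralType G S) (hell : ∀ᵐ H ∂μ, ¬ IsElliptic S H)
    {s : S} {g : ℕ → G} (hy : (∃ η, ConvergesToBoundary (fun n => (g n)⁻¹ • s) η) ∨
      ∃ C, SeparatedDirections s C fun n => (g n)⁻¹ • s) :
    ∀ᵐ H ∂μ, ∀ ζ : GromovBoundary S, H ≤ MulAction.stabilizer G ζ →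
      ∃ C : ℝ, ∀ᶠ n in atTop, g n • ζ ∈ shadow s (g n • s) (dist (g n • s) s - C) := by
  rcases hy with ⟨η, hη⟩ | ⟨C, hC⟩
  · filter_upwards [ae_not_le_stabilizer hell (hG.infinite_orbit η)] with H hH ζ hζ
    exact hη.exists_smul_mem_shadow fun h => hH (h ▸ hζ)
  · exact .of_forall fun H ζ _ => hC.exists_smul_mem_shadow ζ

theorem ae_fixesNoBoundaryPoint (hG : IsGeneralType G S) (hell : ∀ᵐ H ∂μ, ¬ IsElliptic S H) :
    ∀ᵐ H ∂μ, FixesNoBoundaryPoint S H := by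
  obtain ⟨δ, hδ⟩ := exists_isHyperbolicWith S
  obtain ⟨ξ, hξ⟩ := hG.1.nonempty
  have ⟨s, _⟩ := hξ
  obtain ⟨g, hg, hy⟩ := exists_seq_of_mem_limitSet s hξ
  have hshadow (R : ℕ) : ∀ᵐ H ∂μ, ¬ ∃ ζ : GromovBoundary S, H ≤ MulAction.stabilizer G ζ ∧
      ∀ n ≥ R, g n • ζ ∈ shadow s (g n • s) (dist (g n • s) s - R) := by
    refine ae_notMem_of_ae_not_frequently_mem (g := fun n => toConjAct (g n))
      (A := fun n => {H | ∀ h ∈ H, dist (g n • s) s - (R + 2 * δ) - dist (h • s) s ≤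
        gromovProduct s (g n • s) (h • g n • s)})
      (D := {H | ∃ ζ : GromovBoundary S, H ≤ MulAction.stabilizer G ζ ∧
        ∀ n ≥ R, g n • ζ ∈ shadow s (g n • s) (dist (g n • s) s - R)})
      (fun n => measurableSet_forall_mem _) ?_ ?_
    · filter_upwards [eventually_ge_atTop R] with n hn H ⟨ζ, hHζ, hζ⟩ h hh
      have := hδ.le_gromovProduct_smul_of_mem_shadow (hζ n hn)
        (toConjAct_smul_le_stabilizer_smul_iff.2 hHζ hh)
      linarith
    · exact (ae_not_le_stabilizer hell (hG.infinite_orbit ξ)).mono fun H hH hfreq =>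
        hH (hg.le_stabilizer_of_frequently hfreq)
  filter_upwards [ae_all_iff.2 hshadow, ae_exists_smul_mem_shadow hG hell hy] with H hH hζ
  refine fixesNoBoundaryPoint_iff.2 fun ζ hHζ => ?_
  obtain ⟨C, hC⟩ := hζ ζ hHζ
  obtain ⟨R, hR⟩ := exists_nat_forall_ge_of_eventually
    (P := fun n C => g n • ζ ∈ shadow s (g n • s) (dist (g n • s) s - C))
    (fun n C C' hCC' h => shadow_antitone s _ (sub_le_sub_left hCC' _) h) hC
  exact hH R ⟨ζ, hHζ, hR⟩

theorem ae_isGeometricallyDense_or_le_ellipticRadical (hG : IsGeneralType G S) :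
    ∀ᵐ H ∂μ, IsGeometricallyDense S H ∨ H ≤ ellipticRadical G S := by
  have : Nonempty S := ⟨hG.1.nonempty.choose_spec.choose⟩
  have hmeas : MeasurableSet {H : Subgroup G | IsElliptic S H} := measurableSet_isElliptic
  have hinv (g : ConjAct G) (H : Subgroup G) := isElliptic_smul_iff (S := S) (H := H) g
  have hell : ∀ᵐ H ∂μ, IsElliptic S H → H ≤ ellipticRadical G S := by
    have := smulInvariantMeasure_restrict (μ := μ) hmeas hinv
    exact (ae_restrict_iff' hmeas).1 (ae_le_ellipticRadical (ae_restrict_mem hmeas))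
  have hnell : ∀ᵐ H ∂μ, ¬ IsElliptic S H → IsGeometricallyDense S H := by
    have := smulInvariantMeasure_restrict (μ := μ) hmeas.compl fun g H => not_congr (hinv g H)
    have h := ae_restrict_mem (μ := μ) hmeas.compl
    exact (ae_restrict_iff' hmeas.compl).1
      ((ae_limitSet_eq hG h).and (ae_fixesNoBoundaryPoint hG h))
  filter_upwards [hell, hnell] with H h₁ h₂
  exact (em (IsElliptic S H)).symm.imp h₂ h₁

end RandomSubgroup

theorem mainTheorem1_general {G S : Type*} [Group G] [Countable G] [MetricSpace S]
    [GromovHyperbolic S] [MulAction G S] [IsIsometricSMul G S] (hG : IsGeneralType G S)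
    (μ : Measure (Subgroup G)) (hμ : IsIRS μ) :
    IsGreatest {N : Subgroup G | N.Normal ∧ IsElliptic S N} (ellipticRadical G S) ∧
      ∀ᵐ H ∂μ, IsGeometricallyDense S H ∨ H ≤ ellipticRadical G S := by
  have := hμ.isProbabilityMeasure
  have := hμ.smulInvariantMeasure
  exact ⟨isGreatest_ellipticRadical hG.1, ae_isGeometricallyDense_or_le_ellipticRadical hG⟩

theorem mainTheorem1 {G S : Type*} [Group G] [Countable G] [MetricSpace S] [GromovHyperbolic S]
    [MulAction G S] [IsIsometricSMul G S] (hG : IsGeneralType G S)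
    (μ : Measure (Subgroup G)) (hμ : IsErgodicIRS μ) :
    IsGreatest {N : Subgroup G | N.Normal ∧ IsElliptic S N} (ellipticRadical G S) ∧
      ((∀ᵐ H ∂μ, IsGeometricallyDense S H) ∨ (∀ᵐ H ∂μ, H ≤ ellipticRadical G S)) := by
  exact (mainTheorem1_general hG μ hμ.toIsIRS).imp_right
    (hμ.ae_or_ae_of_ae_or (measurableSet_forall_mem _)
      (smul_le_iff_of_normal normal_ellipticRadical))
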